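/- Let $d\in\mathbf N$ and let $\pi$ be a L\'evy measure on $\mathbf R^d$, i.e. a measure with $\pi(\{0\})=0$ and $\int (1\wedge\|x\|^2)\,\pi(dx)<\infty$, and let $$\beta=\inf\Big\{\delta\ge 0:\int (1\wedge\|x\|^\delta)\,\pi(dx)<\infty\Big\}$$ be its Blumenthal–Getoor index. Let $Y=(Y_t)_{t\ge 0}$ be an $\mathbf R^d$-valued L\'evy process (with almost surely càdlàg paths) with generating triplet $(0,0,\mathbf 1_{\{\|x\|\le 1\}}\pi(dx))$, that is, $\mathbf E[e^{i\langle\lambda,Y_t\rangle}]=\exp\big(t\int_{\|x\|\le 1}(e^{i\langle\lambda,x\rangle}-1-i\langle\lambda,x\rangle)\,\pi(dx)\big)$ for all $t\ge 0$ and $\lambda\in\mathbf R^d$. Write $\Delta Y_t=Y_t-Y_{t-}$ for the jump at time $t$ (with $\Delta Y_0=0$) and $S(\omega)=\{t:\Delta Y_t(\omega)\ne 0\}$. For $\delta,\varepsilon>0$ let $$A_\delta^\varepsilon=\bigcup_{s\in S(\omega),\ \|\Delta Y_s\|\le\varepsilon}\big[s-\|\Delta Y_s\|^\delta,\ s+\|\Delta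 Y_s\|^\delta\big],\qquad A_\delta=\limsup_{\varepsilon\to 0^+}A_\delta^\varepsilon=\bigcap_{\varepsilon>0}A_\delta^\varepsilon .$$ For $f:[0,\infty)\to\mathbf R^d$, $t\ge 0$ and $\alpha>0$, write $f\in C^\alpha_t$ if there are $C,\rho>0$ and an $\mathbf R^d$-valued polynomial $P$ of degree less than $\alpha$ with $\|f(u)-P(u)\|\le C|t-u|^\alpha$ for all $u\ge 0$ with $|u-t|<\rho$; the pointwise Hölder exponent of $f$ at $t$ is $\alpha_{f,t}=\sup\{\alpha>0: f\in C^\alpha_t\}\in[0,\infty]$, with $\sup\emptyset=0$. Then for every $\delta>\beta$, almost surely, for all $t\in[0,1]\setminus S(\omega)$, $$t\notin A_\delta\ \Longrightarrow\ \alpha_{Y,t}\ge\frac1\delta .$$ (No further assumption on $\pi$ is made.) -/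

import Mathlib

open MeasureTheory ProbabilityTheory Filter Topology
open scoped NNReal ENNReal

noncomputable section

/-- `π` is a Lévy measure on `ℝ^d`: it does not charge the origin and
`∫ (1 ∧ ‖x‖²) π(dx) < ∞`. -/
structure IsLevyMeasure {d : ℕ} (π : Measure (EuclideanSpace ℝ (Fin d))) : Prop where
  zero : π {0} = 0
  lintegral_lt_top : ∫⁻ x, ENNReal.ofReal (min 1 (‖x‖ ^ 2)) ∂π < ∞

/-- The Lévy–Khintchine exponent `ψ` of the generating triplet `(a, Q, π)`:
`ψ(u) = i⟨a,u⟩ - ⟨u,Qu⟩/2 + ∫ (e^{i⟨u,x⟩} - 1 - i⟨u,x⟩ 1_{‖x‖ ≤ 1}) π(dx)`. -/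
def levyExponent {d : ℕ} (a : EuclideanSpace ℝ (Fin d)) (Q : Matrix (Fin d) (Fin d) ℝ)
    (π : Measure (EuclideanSpace ℝ (Fin d))) (u : EuclideanSpace ℝ (Fin d)) : ℂ :=
  Complex.I * ((inner ℝ a u : ℝ) : ℂ)
    - (1 / 2 : ℂ) * ((dotProduct u.ofLp (Q.mulVec u.ofLp) : ℝ) : ℂ)
    + ∫ x, (Complex.exp (Complex.I * ((inner ℝ u x : ℝ) : ℂ)) - 1
        - (Metric.closedBall (0 : EuclideanSpace ℝ (Fin d)) 1).indicator
            (fun y => Complex.I * ((inner ℝ u y : ℝ) : ℂ)) x) ∂π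

/-- A path on `[0, ∞)` is càdlàg: right-continuous with left limits. -/
def IsCadlag {E : Type*} [TopologicalSpace E] (f : ℝ≥0 → E) : Prop :=
  ∀ t : ℝ≥0, ContinuousWithinAt f (Set.Ici t) t ∧ ∃ l : E, Tendsto f (𝓝[<] t) (𝓝 l)

/-- `X` is an `ℝ^d`-valued Lévy process under `P` with generating triplet `(a, Q, π)`: it starts
at `0`, has independent and stationary increments and càdlàg paths (almost surely), and
`E[e^{i⟨u, X_t⟩}] = e^{t ψ(u)}`. -/
structure IsLevyProcess {Ω : Type*} [MeasurableSpace Ω] {d : ℕ}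
    (X : ℝ≥0 → Ω → EuclideanSpace ℝ (Fin d)) (P : Measure Ω)
    (a : EuclideanSpace ℝ (Fin d)) (Q : Matrix (Fin d) (Fin d) ℝ)
    (π : Measure (EuclideanSpace ℝ (Fin d))) : Prop where
  measurable : ∀ t, Measurable (X t)
  start_zero : ∀ᵐ ω ∂P, X 0 ω = 0
  indep_increments : HasIndepIncrements X P
  stationary_increments : ∀ s h : ℝ≥0, IdentDistrib (fun ω => X (s + h) ω - X s ω) (X h) P P
  cadlag : ∀ᵐ ω ∂P, IsCadlag (fun t => X t ω)
  charFun_eq : ∀ (t : ℝ≥0) (u : EuclideanSpace ℝ (Fin d)),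
    charFun (P.map (X t)) u = Complex.exp (((t : ℝ) : ℂ) * levyExponent a Q π u)

/-- The Blumenthal–Getoor index `β = inf {δ ≥ 0 : ∫ (1 ∧ ‖x‖^δ) π(dx) < ∞}`. -/
def blumenthalGetoorIndex {d : ℕ} (π : Measure (EuclideanSpace ℝ (Fin d))) : ℝ :=
  sInf {δ : ℝ | 0 ≤ δ ∧ ∫⁻ x, ENNReal.ofReal (min 1 (‖x‖ ^ δ)) ∂π < ∞}

/-- The jump `Δf_t = f(t) - f(t-)` of a path at time `t` (it vanishes at `t = 0`). -/
def pathJump {d : ℕ} (f : ℝ≥0 → EuclideanSpace ℝ (Fin d)) (t : ℝ≥0) :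
    EuclideanSpace ℝ (Fin d) :=
  f t - Function.leftLim f t

/-- The set `S` of jump times of a path. -/
def jumpTimes {d : ℕ} (f : ℝ≥0 → EuclideanSpace ℝ (Fin d)) : Set ℝ≥0 :=
  {t | pathJump f t ≠ 0}

/-- The set `A^ε_δ`: the union, over the jump times `s` with `‖Δf_s‖ ≤ ε`, of the intervals
`[s - ‖Δf_s‖^δ, s + ‖Δf_s‖^δ]` (intersected with the time set `[0, ∞)`). -/
def jaffardApprox {d : ℕ} (f : ℝ≥0 → EuclideanSpace ℝ (Fin d)) (δ ε : ℝ) : Set ℝ≥0 :=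
  ⋃ s ∈ {s : ℝ≥0 | s ∈ jumpTimes f ∧ ‖pathJump f s‖ ≤ ε},
    {u : ℝ≥0 | (u : ℝ) ∈ Set.Icc ((s : ℝ) - ‖pathJump f s‖ ^ δ) ((s : ℝ) + ‖pathJump f s‖ ^ δ)}

/-- The set `A_δ`, the limit superior of the sets `A^ε_δ` as `ε → 0+`. -/
def jaffardSet {d : ℕ} (f : ℝ≥0 → EuclideanSpace ℝ (Fin d)) (δ : ℝ) : Set ℝ≥0 :=
  limsup (fun ε : ℝ => jaffardApprox f δ ε) (𝓝[>] 0)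

/-- The path `f : [0, ∞) → ℝ^d` belongs to `C^α_t`: there are `C, ρ > 0` and an `ℝ^d`-valued
polynomial of degree less than `α` (given by its coordinates) with
`‖f(u) - P(u)‖ ≤ C |t - u|^α` at all times `u` with `|u - t| < ρ`. -/
def MemPointwiseHolder {d : ℕ} (f : ℝ≥0 → EuclideanSpace ℝ (Fin d)) (t : ℝ≥0) (α : ℝ) : Prop :=
  ∃ C > 0, ∃ ρ > 0, ∃ p : Fin d → Polynomial ℝ,
    (∀ i, ((p i).natDegree : ℝ) < α) ∧
    ∀ u : ℝ≥0, |(u : ℝ) - t| < ρ →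
      ‖f u - WithLp.toLp 2 (fun i => (p i).eval (u : ℝ))‖ ≤ C * |(t : ℝ) - u| ^ α

/-- The pointwise Hölder exponent `sup {α : f ∈ C^α_t}` in `[0, ∞]`, with `sup ∅ = 0`. -/
def pointwiseHolderExponent {d : ℕ} (f : ℝ≥0 → EuclideanSpace ℝ (Fin d)) (t : ℝ≥0) : ℝ≥0∞ :=
  sSup {h : ℝ≥0∞ | ∃ α : ℝ, 0 < α ∧ MemPointwiseHolder f t α ∧ h = ENNReal.ofReal α}

end

/-!
The Lévy–Itô decomposition is avoided: jumps of the path are detected through increments over fine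
meshes, and laws enter only through characteristic functions.

Let `p = min δ 2`. Since `δ` exceeds the Blumenthal–Getoor index, `∫_{‖x‖ ≤ 1} ‖x‖ ^ p dπ < ∞`, and
for a suitable drift `b` (zero if `δ ≥ 1`, the mean `∫_{‖x‖ ≤ 1} x dπ` of the jumps if `δ < 1`) the
process `Z_t = Y_t + t b` has an exponent `φ` with `|φ(u)| ≤ C ‖u‖ ^ p`
(`exists_norm_levyExponent_add_drift_le`).

The function `g(x) = 2 + sin x / 2 - cos x` is nonnegative, dominates `exp (x / 2)` on `[-1, 1]`,
and its expectation is controlled by the characteristic function at `1`. Multiplying such factors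
over the increments of a coordinate of `Z / ε` along a mesh gives an exponential maximal inequality
on the event that all these increments are at most one in absolute value
(`measure_exists_le_sum_le`). A càdlàg path whose jumps in a window have size at most `ε / 2` has
increments at most `ε` over fine meshes (`exists_forall_dist_lt_of_jump_le`), so letting the mesh
tend to zero bounds the probability that `Z` moves by more than `M ε` in a window of length `L`
which contains no jump larger than `ε / 2`, by a constant times `exp (-M / 2)` as long as
`L ≤ ε ^ p`. With `L = 2⁻ⁿ`, `ε = 2 L ^ (1 / δ)`, `M = 4 n`, Borel–Cantelli yields
`ae_eventually_hasWindowControl`.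

If `t` is neither a jump time nor in the limsup set, the jumps near `t` are at most the power
`1 / δ` of their distance to `t`, hence the windows around `t` contain no large jumps and
`‖Z_u - Z_t‖ ≤ K n 2 ^ (-n / δ)` for `|u - t|` of order `2⁻ⁿ`. This is `O(|u - t| ^ α)` for every
`α < 1 / δ`, and `Y` differs from `Z` by a polynomial of degree zero if `δ ≥ 1`, and of degree at
most one if `δ < 1`, in which case exponents `α > 1` may be used.
-/

/-! ### Walks with bounded steps -/

/-- A trigonometric polynomial dominates an exponential on `[-1, 1]`; its expectation is an
expression in the characteristic function, whereas the exponential need not be integrable. -/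
lemma exp_half_le_two_add_sin_sub_cos {x : ℝ} (hx : |x| ≤ 1) :
    Real.exp (x / 2) ≤ 2 + Real.sin x / 2 - Real.cos x := by
  have h1 := (abs_le.1 (Real.abs_exp_sub_one_sub_id_le (x := x / 2)
    (by rw [abs_div]; norm_num; linarith))).2
  have h2 := (abs_le.1 (Real.cos_bound hx)).2
  have h3 := (abs_le.1 (Real.sin_bound hx)).1
  have h4 : |x| ^ 4 ≤ x ^ 2 := by
    calc |x| ^ 4 = x ^ 2 * |x| ^ 2 := by rw [← sq_abs x]; ring
      _ ≤ x ^ 2 * 1 := by gcongr; exact pow_le_one₀ (abs_nonneg x) hx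
      _ = x ^ 2 := mul_one _
  have h5 : x ^ 3 ≤ x ^ 2 := by
    calc x ^ 3 = x ^ 2 * x := by ring
      _ ≤ x ^ 2 * 1 := by gcongr; exact (le_abs_self x).trans hx
      _ = x ^ 2 := mul_one _
  have h6 : |x| ^ 5 ≤ x ^ 2 := by
    calc |x| ^ 5 = |x| ^ 4 * |x| := by ring
      _ ≤ x ^ 2 * 1 := by gcongr
      _ = x ^ 2 := mul_one _
  nlinarith [sq_nonneg x]

/-- The running product of a sequence of factors, frozen from the first time at which it
reaches the level `l`. -/
noncomputable def stoppedProd (l : ℝ≥0∞) (g : ℕ → ℝ≥0∞) : ℕ → ℝ≥0∞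
  | 0 => 1
  | k + 1 => if l ≤ stoppedProd l g k then stoppedProd l g k else stoppedProd l g k * g k

lemma stoppedProd_congr {l : ℝ≥0∞} {g g' : ℕ → ℝ≥0∞} {n : ℕ} (h : ∀ j < n, g j = g' j) :
    stoppedProd l g n = stoppedProd l g' n := by
  induction n with
  | zero => rfl
  | succ n ih =>
    simp only [stoppedProd]
    rw [ih fun j hj => h j (hj.trans n.lt_succ_self), h n n.lt_succ_self]

lemma measurable_stoppedProd {α : Type*} [MeasurableSpace α] {l : ℝ≥0∞} {g : ℕ → α → ℝ≥0∞}
    (hg : ∀ j, Measurable (g j)) (n : ℕ) :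
    Measurable fun x => stoppedProd l (fun j => g j x) n := by
  induction n with
  | zero => exact measurable_const
  | succ n ih =>
    exact Measurable.ite (measurableSet_le measurable_const ih) ih (ih.mul (hg n))

lemma le_stoppedProd_of_le {l : ℝ≥0∞} {g : ℕ → ℝ≥0∞} {k n : ℕ} (hkn : k ≤ n)
    (h : l ≤ stoppedProd l g k) : l ≤ stoppedProd l g n := by
  induction n, hkn using Nat.le_induction with
  | base => exact h
  | succ n _ ih => simp [stoppedProd, ih]

lemma le_stoppedProd_of_le_prod {l : ℝ≥0∞} {g : ℕ → ℝ≥0∞} {k n : ℕ} (hkn : k ≤ n)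
    (h : l ≤ ∏ j ∈ Finset.range k, g j) : l ≤ stoppedProd l g n := by
  have key : ∀ m, l ≤ stoppedProd l g m ∨ stoppedProd l g m = ∏ j ∈ Finset.range m, g j := by
    intro m
    induction m with
    | zero => right; simp [stoppedProd]
    | succ m ih =>
      by_cases hm : l ≤ stoppedProd l g m
      · exact Or.inl (le_stoppedProd_of_le m.le_succ hm)
      · right
        rw [Finset.prod_range_succ, ← ih.resolve_left hm]
        simp [stoppedProd, hm]
  refine le_stoppedProd_of_le hkn ?_
  rcases key k with h' | h'
  · exact h'
  · exact h' ▸ h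

section Walk

variable {Ω : Type*} [MeasurableSpace Ω] {P : Measure Ω} [IsProbabilityMeasure P]

/-- In each step the expectation of the running part grows by a factor of at most `r`, as the new
factor is independent of the past, and the frozen part does not grow at all; here `1 ≤ r`. -/
lemma lintegral_stoppedProd_le {g : ℕ → Ω → ℝ≥0∞} (hg : ∀ j, Measurable (g j))
    (hind : iIndepFun g P) {r : ℝ≥0∞} (hr : 1 ≤ r) (hgr : ∀ j, ∫⁻ ω, g j ω ∂P ≤ r)
    (l : ℝ≥0∞) (n : ℕ) :
    ∫⁻ ω, stoppedProd l (fun j => g j ω) n ∂P ≤ r ^ n := by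
  induction n with
  | zero => simp [stoppedProd]
  | succ n ih =>
    set T : Ω → ℝ≥0∞ := fun ω => stoppedProd l (fun j => g j ω) n with hT
    have hTm : Measurable T := measurable_stoppedProd hg n
    -- the part of the product which is still running at time `n`
    let R : ℝ≥0∞ → ℝ≥0∞ := fun x => if l ≤ x then 0 else x
    have hR : Measurable R :=
      Measurable.ite (measurableSet_le measurable_const measurable_id) measurable_const
        measurable_id
    -- the part which is frozen at time `n`
    let F : ℝ≥0∞ → ℝ≥0∞ := fun x => if l ≤ x then x else 0
    have hF : Measurable F :=
      Measurable.ite (measurableSet_le measurable_const measurable_id) measurable_id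
        measurable_const
    have hindep : IndepFun T (g n) P := by
      have h := hind.indepFun_finset (Finset.range n) {n} (by simp) hg
      let ext : (Finset.range n → ℝ≥0∞) → ℕ → ℝ≥0∞ :=
        fun y j => if h : j ∈ Finset.range n then y ⟨j, h⟩ else 1
      have hext : ∀ j, Measurable fun y => ext y j := by
        intro j
        by_cases hj : j ∈ Finset.range n
        · simp only [ext, hj, dif_pos]; fun_prop
        · simp only [ext, hj, dif_neg, not_false_iff]; fun_prop
      have hproj : Measurable fun y : ({n} : Finset ℕ) → ℝ≥0∞ =>
          y ⟨n, Finset.mem_singleton_self n⟩ := measurable_pi_apply _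
      have h' := h.comp (measurable_stoppedProd (l := l) (g := fun j y => ext y j) hext n) hproj
      convert h' using 1
      · funext ω
        refine stoppedProd_congr fun j hj => ?_
        simp [ext, hj]
      · rfl
    have hsplit : ∀ ω, stoppedProd l (fun j => g j ω) (n + 1) = F (T ω) + R (T ω) * g n ω := by
      intro ω
      by_cases h : l ≤ T ω
      · have h2 : l ≤ stoppedProd l (fun j => g j ω) n := h
        simp only [stoppedProd, F, R, h, h2, if_true, zero_mul, add_zero]
        rfl
      · have h2 : ¬ l ≤ stoppedProd l (fun j => g j ω) n := h
        simp only [stoppedProd, F, R, h, h2, if_false, zero_add]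
        rfl
    calc ∫⁻ ω, stoppedProd l (fun j => g j ω) (n + 1) ∂P
        = ∫⁻ ω, F (T ω) ∂P + ∫⁻ ω, R (T ω) * g n ω ∂P := by
          simp_rw [hsplit]
          exact lintegral_add_left (hF.comp hTm) _
      _ = ∫⁻ ω, F (T ω) ∂P + (∫⁻ ω, R (T ω) ∂P) * ∫⁻ ω, g n ω ∂P := by
          congr 1
          exact lintegral_mul_eq_lintegral_mul_lintegral_of_indepFun''
            (hR.comp hTm).aemeasurable (hg n).aemeasurable (hindep.comp hR measurable_id)
      _ ≤ (∫⁻ ω, F (T ω) ∂P) * r + (∫⁻ ω, R (T ω) ∂P) * r := by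
          gcongr
          · exact le_mul_of_one_le_right' hr
          · exact hgr n
      _ = (∫⁻ ω, T ω ∂P) * r := by
          have h := lintegral_add_left (μ := P) (hF.comp hTm) (R ∘ T)
          simp only [Function.comp_apply] at h
          rw [← add_mul, ← h]
          congr 2
          funext ω
          by_cases h : l ≤ T ω <;> simp [F, R, h]
      _ ≤ r ^ n * r := by gcongr
      _ = r ^ (n + 1) := (pow_succ r n).symm

/-- Exponential maximal inequality for a walk with independent steps on the event that all steps
are at most one in absolute value; the steps enter through their characteristic functions only. -/
lemma measure_exists_le_sum_le {ξ : ℕ → Ω → ℝ} (hξ : ∀ j, Measurable (ξ j))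
    (hind : iIndepFun ξ P) {c : ℝ} (hc : 0 ≤ c)
    (hchar : ∀ j, ‖(∫ ω, Complex.exp (Complex.I * (ξ j ω : ℂ)) ∂P) - 1‖ ≤ c) (n : ℕ) (M : ℝ) :
    P {ω | (∀ j < n, |ξ j ω| ≤ 1) ∧ ∃ k ≤ n, M ≤ ∑ j ∈ Finset.range k, ξ j ω}
      ≤ ENNReal.ofReal (Real.exp (3 / 2 * c * n - M / 2)) := by
  let f : ℝ → ℝ := fun x => 2 + Real.sin x / 2 - Real.cos x
  have hf0 : ∀ x, 0 ≤ f x := fun x => by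
    have := Real.neg_one_le_sin x
    have := Real.cos_le_one x
    simp only [f]; linarith
  have hfm : Measurable f := by fun_prop
  let g : ℕ → Ω → ℝ≥0∞ := fun j ω => ENNReal.ofReal (f (ξ j ω))
  have hg : ∀ j, Measurable (g j) := fun j => (hfm.comp (hξ j)).ennreal_ofReal
  have hgind : iIndepFun g P :=
    hind.comp (fun _ x => ENNReal.ofReal (f x)) fun _ => hfm.ennreal_ofReal
  have hgr : ∀ j, ∫⁻ ω, g j ω ∂P ≤ ENNReal.ofReal (1 + 3 / 2 * c) := by
    intro j
    have hint : Integrable (fun ω => Complex.exp (Complex.I * (ξ j ω : ℂ))) P := by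
      refine Integrable.of_bound (C := 1) ?_ (ae_of_all _ fun ω => ?_)
      · have := hξ j
        exact (by fun_prop : Measurable _).aestronglyMeasurable
      · rw [mul_comm, Complex.norm_exp_ofReal_mul_I]
    have hre : ∀ ω, (Complex.exp (Complex.I * (ξ j ω : ℂ))).re = Real.cos (ξ j ω) := fun ω => by
      rw [mul_comm, Complex.exp_ofReal_mul_I_re]
    have him : ∀ ω, (Complex.exp (Complex.I * (ξ j ω : ℂ))).im = Real.sin (ξ j ω) := fun ω => by
      rw [mul_comm, Complex.exp_ofReal_mul_I_im]
    have hcos : Integrable (fun ω => Real.cos (ξ j ω)) P := by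
      simpa only [RCLike.re_to_complex, hre] using hint.re
    have hsin : Integrable (fun ω => Real.sin (ξ j ω)) P := by
      simpa only [RCLike.im_to_complex, him] using hint.im
    have hcosI : ∫ ω, Real.cos (ξ j ω) ∂P = (∫ ω, Complex.exp (Complex.I * (ξ j ω : ℂ)) ∂P).re := by
      have := integral_re hint
      simpa only [RCLike.re_to_complex, hre] using this
    have hsinI : ∫ ω, Real.sin (ξ j ω) ∂P = (∫ ω, Complex.exp (Complex.I * (ξ j ω : ℂ)) ∂P).im := by
      have := integral_im hint
      simpa only [RCLike.im_to_complex, him] using this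
    have hfint : Integrable (fun ω => f (ξ j ω)) P :=
      ((integrable_const 2).add (hsin.div_const 2)).sub hcos
    have hfI : ∫ ω, f (ξ j ω) ∂P
        = 2 + (∫ ω, Real.sin (ξ j ω) ∂P) / 2 - ∫ ω, Real.cos (ξ j ω) ∂P := by
      have e1 := integral_sub ((integrable_const (2 : ℝ)).add (hsin.div_const 2)) hcos
      have e2 := integral_add (integrable_const (μ := P) (2 : ℝ)) (hsin.div_const 2)
      simp only [Pi.add_apply] at e1
      simp only [f]
      rw [e1, e2, integral_div]
      simp
    rw [← ofReal_integral_eq_lintegral_ofReal hfint (ae_of_all _ fun ω => hf0 _), hfI, hcosI, hsinI]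
    refine ENNReal.ofReal_le_ofReal ?_
    set z := ∫ ω, Complex.exp (Complex.I * (ξ j ω : ℂ)) ∂P with hz
    have h1 := (Complex.abs_re_le_norm (z - 1)).trans (hchar j)
    have h2 := (Complex.abs_im_le_norm (z - 1)).trans (hchar j)
    simp only [Complex.sub_re, Complex.sub_im, Complex.one_re, Complex.one_im, sub_zero] at h1 h2
    have := (abs_le.1 h1).1
    have := (abs_le.1 h2).2
    linarith
  set l := ENNReal.ofReal (Real.exp (M / 2)) with hl
  have hl0 : l ≠ 0 := by simp [hl, Real.exp_pos]
  have hlt : l ≠ ∞ := ENNReal.ofReal_ne_top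
  have hsub : {ω | (∀ j < n, |ξ j ω| ≤ 1) ∧ ∃ k ≤ n, M ≤ ∑ j ∈ Finset.range k, ξ j ω}
      ⊆ {ω | l ≤ stoppedProd l (fun j => g j ω) n} := by
    rintro ω ⟨hω, k, hk, hM⟩
    refine le_stoppedProd_of_le_prod hk ?_
    simp only [g, hl]
    rw [← ENNReal.ofReal_prod_of_nonneg fun j _ => hf0 _]
    refine ENNReal.ofReal_le_ofReal ?_
    calc Real.exp (M / 2) ≤ Real.exp (∑ j ∈ Finset.range k, ξ j ω / 2) := by
          rw [← Finset.sum_div]; gcongr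
      _ = ∏ j ∈ Finset.range k, Real.exp (ξ j ω / 2) := Real.exp_sum _ _
      _ ≤ ∏ j ∈ Finset.range k, f (ξ j ω) := by
          refine Finset.prod_le_prod (fun j _ => (Real.exp_pos _).le) fun j hj => ?_
          exact exp_half_le_two_add_sin_sub_cos
            (hω j ((Finset.mem_range.1 hj).trans_le hk))
  have hmark := mul_meas_ge_le_lintegral (μ := P) (measurable_stoppedProd (l := l) hg n) l
  have hlin := lintegral_stoppedProd_le hg hgind (r := ENNReal.ofReal (1 + 3 / 2 * c))
    (by rw [← ENNReal.ofReal_one]; exact ENNReal.ofReal_le_ofReal (by linarith)) hgr l n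
  calc P {ω | (∀ j < n, |ξ j ω| ≤ 1) ∧ ∃ k ≤ n, M ≤ ∑ j ∈ Finset.range k, ξ j ω}
      ≤ P {ω | l ≤ stoppedProd l (fun j => g j ω) n} := measure_mono hsub
    _ ≤ ENNReal.ofReal (1 + 3 / 2 * c) ^ n / l := by
        rw [ENNReal.le_div_iff_mul_le (Or.inl hl0) (Or.inl hlt), mul_comm]
        exact hmark.trans hlin
    _ = ENNReal.ofReal ((1 + 3 / 2 * c) ^ n / Real.exp (M / 2)) := by
        rw [ENNReal.ofReal_div_of_pos (Real.exp_pos _), ENNReal.ofReal_pow (by positivity)]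
    _ ≤ ENNReal.ofReal (Real.exp (3 / 2 * c * n - M / 2)) := by
        refine ENNReal.ofReal_le_ofReal ?_
        rw [Real.exp_sub]
        gcongr
        calc (1 + 3 / 2 * c) ^ n ≤ (Real.exp (3 / 2 * c)) ^ n := by
              gcongr
              linarith [Real.add_one_le_exp (3 / 2 * c)]
          _ = Real.exp (3 / 2 * c * n) := by rw [← Real.exp_nat_mul]; ring_nf

end Walk

/-! ### Càdlàg paths and windows -/

/-- A càdlàg function whose jumps in a compact interval are at most `η` oscillates by at most any
given `ε > η` on all sufficiently short subintervals. -/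
lemma exists_forall_dist_lt_of_jump_le {f : ℝ≥0 → ℝ} {a b : ℝ≥0} {η ε : ℝ} (hε : η < ε)
    (hr : ∀ s ∈ Set.Icc a b, ContinuousWithinAt f (Set.Ici s) s)
    (hl : ∀ s ∈ Set.Icc a b, ∃ l, Tendsto f (𝓝[<] s) (𝓝 l) ∧ |f s - l| ≤ η) :
    ∃ θ > 0, ∀ s ∈ Set.Icc a b, ∀ t ∈ Set.Icc a b, dist s t < θ → |f s - f t| ≤ ε := by
  have key : ∀ s : Set.Icc a b, ∃ U : Set ℝ≥0, IsOpen U ∧ (s : ℝ≥0) ∈ U ∧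
      ∀ x ∈ U, ∀ y ∈ U, |f x - f y| ≤ ε := by
    rintro ⟨s, hs⟩
    obtain ⟨l, hl1, hl2⟩ := hl s hs
    set κ := (ε - η) / 2 with hκ
    have hκ0 : 0 < κ := by rw [hκ]; linarith
    have e1 : ∀ᶠ x in 𝓝[≥] s, |f x - f s| < κ := by
      simpa [Real.dist_eq] using (hr s hs).eventually (Metric.ball_mem_nhds (f s) hκ0)
    have e2 : ∀ᶠ x in 𝓝[<] s, |f x - l| < κ := by
      simpa [Real.dist_eq] using hl1.eventually (Metric.ball_mem_nhds l hκ0)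
    have e3 : ∀ᶠ x in 𝓝 s, (s ≤ x → |f x - f s| < κ) ∧ (x < s → |f x - l| < κ) :=
      (eventually_nhdsWithin_iff.1 e1).and (eventually_nhdsWithin_iff.1 e2)
    obtain ⟨U, hU, hUo, hsU⟩ := eventually_nhds_iff.1 e3
    refine ⟨U, hUo, hsU, fun x hx y hy => ?_⟩
    have hx' := hU x hx
    have hy' := hU y hy
    have h2κ : 2 * κ = ε - η := by rw [hκ]; ring
    have hη := abs_le.1 hl2
    rw [abs_le]
    rcases le_or_gt s x with h1 | h1 <;> rcases le_or_gt s y with h2 | h2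
    · have := abs_lt.1 (hx'.1 h1); have := abs_lt.1 (hy'.1 h2); constructor <;> linarith
    · have := abs_lt.1 (hx'.1 h1); have := abs_lt.1 (hy'.2 h2); constructor <;> linarith
    · have := abs_lt.1 (hx'.2 h1); have := abs_lt.1 (hy'.1 h2); constructor <;> linarith
    · have := abs_lt.1 (hx'.2 h1); have := abs_lt.1 (hy'.2 h2); constructor <;> linarith
  choose U hUo hsU hU using key
  obtain ⟨θ, hθ, h⟩ := lebesgue_number_lemma_of_metric (isCompact_Icc (a := a) (b := b)) hUo
    fun s hs => Set.mem_iUnion.2 ⟨⟨s, hs⟩, hsU ⟨s, hs⟩⟩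
  refine ⟨θ, hθ, fun s hs t _ hst => ?_⟩
  obtain ⟨i, hi⟩ := h s hs
  exact hU i s (hi (Metric.mem_ball_self hθ)) t (hi (by rwa [Metric.mem_ball, dist_comm]))

/-- The probability that a process with independent increments rises by more than `M` in the
window `[a, a + L]`, although its increments over short subintervals are at most one. -/
lemma measure_exists_lt_sub_le {Ω : Type*} [MeasurableSpace Ω] {P : Measure Ω}
    [IsProbabilityMeasure P] {W : ℝ≥0 → Ω → ℝ} (hW : ∀ t, Measurable (W t))
    (hind : HasIndepIncrements W P) {c : ℝ} (hc : 0 ≤ c)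
    (hchar : ∀ s h : ℝ≥0,
      ‖(∫ ω, Complex.exp (Complex.I * ((W (s + h) ω - W s ω : ℝ) : ℂ)) ∂P) - 1‖ ≤ c * h)
    (a : ℝ≥0) {L : ℝ≥0} (hL : 0 < L) (M : ℝ) :
    P {ω | (∀ t, ContinuousWithinAt (fun s => W s ω) (Set.Ici t) t) ∧
        (∃ θ > 0, ∀ s ∈ Set.Icc a (a + L), ∀ t ∈ Set.Icc a (a + L), dist s t < θ →
          |W s ω - W t ω| ≤ 1) ∧
        ∃ t ∈ Set.Icc a (a + L), M < W t ω - W a ω}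
      ≤ ENNReal.ofReal (Real.exp (3 / 2 * (c * L) - M / 2)) := by
  -- the increments over the mesh of size `L / m`
  let τ : ℕ → ℕ → ℝ≥0 := fun m j => a + j * (L / m)
  have hτs : ∀ m j, τ m (j + 1) = τ m j + L / m := fun m j => by
    simp only [τ]; push_cast; ring
  let ξ : ℕ → ℕ → Ω → ℝ := fun m j ω => W (τ m (j + 1)) ω - W (τ m j) ω
  have hsum : ∀ m k ω, ∑ j ∈ Finset.range k, ξ m j ω = W (τ m k) ω - W a ω := fun m k ω => by
    rw [Finset.sum_range_sub (fun j => W (τ m j) ω) k]; simp [τ]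
  -- every mesh fine enough for `ω` sees bounded steps and a rise by `M`; as the required fineness
  -- depends on `ω`, the event is covered by the limit inferior of the sets `B m`
  let B : ℕ → Set Ω := fun m =>
    {ω | (∀ j < m, |ξ m j ω| ≤ 1) ∧ ∃ k ≤ m, M ≤ ∑ j ∈ Finset.range k, ξ m j ω}
  set q := ENNReal.ofReal (Real.exp (3 / 2 * (c * L) - M / 2)) with hq
  have hB : ∀ m, 0 < m → P (B m) ≤ q := by
    intro m hm
    have hmono : Monotone (τ m) := monotone_nat_of_le_succ fun j => by
      rw [hτs]; exact le_self_add
    have h := measure_exists_le_sum_le (P := P) (ξ := ξ m) (fun j => (hW _).sub (hW _))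
      (hind.nat hmono) (c := c * (L / m : ℝ≥0)) (by positivity)
      (fun j => by simpa only [ξ, hτs] using hchar (τ m j) (L / m)) m M
    refine h.trans (le_of_eq ?_)
    rw [hq]
    congr 3
    have : (m : ℝ) ≠ 0 := by exact_mod_cast hm.ne'
    push_cast
    field_simp
  have hG : ∀ m₀, P (⋂ m ≥ m₀, B m) ≤ q := fun m₀ =>
    (measure_mono (Set.iInter₂_subset (max m₀ 1) (le_max_left _ _))).trans
      (hB _ (by simp))
  have hGmono : Monotone fun m₀ : ℕ => ⋂ m ≥ m₀, B m := fun i j hij =>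
    Set.biInter_subset_biInter_left fun m hm => le_trans hij hm
  refine (measure_mono (t := ⋃ m₀ : ℕ, ⋂ m ≥ m₀, B m) ?_).trans ?_
  swap
  · rw [hGmono.measure_iUnion]; exact iSup_le hG
  rintro ω ⟨hrc, ⟨θ, hθ, hosc⟩, t, ht, hM⟩
  -- by right continuity the level `M` is exceeded on an interval `[t, t + η)`
  have hev : ∀ᶠ x in 𝓝[≥] t, M < W x ω - W a ω := by
    have h1 : Tendsto (fun x => W x ω - W a ω) (𝓝[≥] t) (𝓝 (W t ω - W a ω)) :=
      (hrc t).sub_const _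
    exact h1.eventually (lt_mem_nhds hM)
  obtain ⟨η, hη, hball⟩ := Metric.eventually_nhds_iff.1 (eventually_nhdsWithin_iff.1 hev)
  have hLr : (0 : ℝ) < L := hL
  have hlim : Tendsto (fun m : ℕ => (L : ℝ) / m) atTop (𝓝 0) :=
    tendsto_const_div_atTop_nhds_zero_nat _
  have hsm : ∀ᶠ m : ℕ in atTop, (L : ℝ) / m < θ ∧ (L : ℝ) / m < η ∧ 0 < m :=
    ((hlim.eventually (gt_mem_nhds hθ)).and
      ((hlim.eventually (gt_mem_nhds hη)).and (eventually_gt_atTop 0)))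
  obtain ⟨m₀, hm₀⟩ := eventually_atTop.1 hsm
  refine Set.mem_iUnion.2 ⟨m₀, Set.mem_iInter₂.2 fun m hm => ?_⟩
  obtain ⟨h1, h2, h3⟩ := hm₀ m hm
  have hmr : (0 : ℝ) < m := by exact_mod_cast h3
  have hτr : ∀ j, (τ m j : ℝ) = a + j * (L / m) := fun j => by simp [τ]
  have hτmem : ∀ j ≤ m, τ m j ∈ Set.Icc a (a + L) := fun j hj => by
    refine ⟨le_self_add, ?_⟩
    rw [← NNReal.coe_le_coe, hτr, NNReal.coe_add]
    have : (j : ℝ) ≤ m := by exact_mod_cast hj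
    have : (j : ℝ) * (L / m) ≤ m * (L / m) := by gcongr
    rw [mul_div_cancel₀ _ hmr.ne'] at this
    linarith
  refine ⟨fun j hj => ?_, ?_⟩
  · refine hosc _ (hτmem _ hj) _ (hτmem _ hj.le) ?_
    rw [NNReal.dist_eq, hτr, hτr]
    push_cast
    rw [show (a + (j + 1) * (L / m) - (a + j * (L / m)) : ℝ) = L / m by ring,
      abs_of_pos (by positivity)]
    exact h1
  · have hta : (0 : ℝ) ≤ t - a := sub_nonneg.2 (NNReal.coe_le_coe.2 ht.1)
    have htL : (t : ℝ) - a ≤ L := by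
      have := NNReal.coe_le_coe.2 ht.2
      push_cast at this; linarith
    set k := ⌈((t : ℝ) - a) / (L / m)⌉₊ with hk
    have hstep : (0 : ℝ) < L / m := by positivity
    have hk1 : (t : ℝ) - a ≤ k * (L / m) := (div_le_iff₀ hstep).1 (Nat.le_ceil _)
    have hk2 : (k : ℝ) * (L / m) < t - a + L / m := by
      have := Nat.ceil_lt_add_one (a := ((t : ℝ) - a) / (L / m)) (by positivity)
      rw [← hk] at this
      calc (k : ℝ) * (L / m) < (((t : ℝ) - a) / (L / m) + 1) * (L / m) := by gcongr
        _ = t - a + L / m := by rw [add_mul, div_mul_cancel₀ _ hstep.ne', one_mul]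
    have hkm : k ≤ m := by
      refine Nat.ceil_le.2 ?_
      rw [div_le_iff₀ hstep, mul_div_cancel₀ _ hmr.ne']
      exact htL
    refine ⟨k, hkm, ?_⟩
    rw [hsum]
    refine (hball ?_ ?_).le
    · rw [NNReal.dist_eq, hτr, abs_of_nonneg (by linarith)]
      linarith
    · show t ≤ τ m k
      rw [← NNReal.coe_le_coe, hτr]; linarith

/-- Near a point of continuity, a function with left limits has only small jumps. -/
lemma exists_forall_norm_pathJump_le {d : ℕ} {f : ℝ≥0 → EuclideanSpace ℝ (Fin d)}
    (hf : IsCadlag f) {t : ℝ≥0} (ht : t ∉ jumpTimes f) {ε : ℝ} (hε : 0 < ε) :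
    ∃ ρ > 0, ∀ s, dist s t < ρ → ‖pathJump f s‖ ≤ ε := by
  have hjump : f t = Function.leftLim f t := by
    simpa [jumpTimes, pathJump, sub_eq_zero] using ht
  have e1 : ∀ᶠ x in 𝓝[≥] t, dist (f x) (f t) < ε / 2 :=
    (hf t).1.eventually (Metric.ball_mem_nhds (f t) (half_pos hε))
  have e2 : ∀ᶠ x in 𝓝[<] t, dist (f x) (f t) < ε / 2 := by
    have h := tendsto_leftLim_of_tendsto (hf t).2
    rw [← hjump] at h
    exact h.eventually (Metric.ball_mem_nhds (f t) (half_pos hε))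
  have e3 : ∀ᶠ x in 𝓝 t, dist (f x) (f t) < ε / 2 := by
    rw [← nhdsLT_sup_nhdsGE t]
    exact eventually_sup.2 ⟨e2, e1⟩
  obtain ⟨ρ, hρ, h⟩ := Metric.eventually_nhds_iff.1 e3
  refine ⟨ρ, hρ, fun s hs => ?_⟩
  have hs1 := h hs
  have hs2 : dist (Function.leftLim f s) (f t) ≤ ε / 2 := by
    -- at the left end point of the time set `leftLim` is the value of the function
    by_cases hbot : 𝓝[<] s = ⊥
    · rw [leftLim_eq_of_eq_bot f hbot]; exact hs1.le
    · have : (𝓝[<] s).NeBot := neBot_iff.2 hbot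
      refine le_of_tendsto ((tendsto_leftLim_of_tendsto (hf s).2).dist tendsto_const_nhds) ?_
      refine nhdsWithin_le_nhds ?_
      filter_upwards [Metric.isOpen_ball.mem_nhds (Metric.mem_ball.2 hs)] with x hx
      exact (h hx).le
  rw [pathJump, ← dist_eq_norm]
  linarith [dist_triangle_right (f s) (Function.leftLim f s) (f t)]

/-! ### The exponent above the Blumenthal–Getoor index -/

lemma norm_exp_I_mul_sub_one_le_rpow {p : ℝ} (hp0 : 0 ≤ p) (hp1 : p ≤ 1) (y : ℝ) :
    ‖Complex.exp (Complex.I * y) - 1‖ ≤ 2 * |y| ^ p := by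
  have hy0 := abs_nonneg y
  rcases le_total |y| 1 with h | h
  · have h1 := Real.norm_exp_I_mul_ofReal_sub_one_le (x := y)
    rw [Real.norm_eq_abs] at h1
    have h2 := Real.rpow_le_rpow_of_exponent_ge' hy0 h hp0 hp1
    rw [Real.rpow_one] at h2
    linarith
  · calc ‖Complex.exp (Complex.I * y) - 1‖
        ≤ ‖Complex.exp (Complex.I * y)‖ + ‖(1 : ℂ)‖ := norm_sub_le _ _
      _ = 2 * 1 := by rw [mul_comm, Complex.norm_exp_ofReal_mul_I]; norm_num
      _ ≤ 2 * |y| ^ p := by gcongr; exact Real.one_le_rpow h hp0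

lemma norm_exp_I_mul_sub_one_sub_le_rpow {p : ℝ} (hp1 : 1 ≤ p) (hp2 : p ≤ 2) (y : ℝ) :
    ‖Complex.exp (Complex.I * y) - 1 - Complex.I * y‖ ≤ 3 * |y| ^ p := by
  have hy0 := abs_nonneg y
  have hn : ‖Complex.I * (y : ℂ)‖ = |y| := by simp
  rcases le_total |y| 1 with h | h
  · have h1 := Complex.norm_exp_sub_one_sub_id_le (x := Complex.I * y) (by rwa [hn])
    rw [hn] at h1
    have h2 : |y| ^ 2 ≤ |y| ^ p := by
      rw [← Real.rpow_two]
      exact Real.rpow_le_rpow_of_exponent_ge' hy0 h (by linarith) hp2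
    linarith [Real.rpow_nonneg hy0 p]
  · have h1 : ‖Complex.exp (Complex.I * y) - 1 - Complex.I * y‖ ≤ 2 + |y| := by
      calc _ ≤ ‖Complex.exp (Complex.I * y) - 1‖ + ‖Complex.I * (y : ℂ)‖ := norm_sub_le _ _
        _ ≤ (‖Complex.exp (Complex.I * y)‖ + ‖(1 : ℂ)‖) + |y| := by
          rw [hn]; gcongr; exact norm_sub_le _ _
        _ = 2 + |y| := by
          rw [mul_comm, Complex.norm_exp_ofReal_mul_I]; norm_num
    have h2 : |y| ≤ |y| ^ p := by
      simpa using Real.rpow_le_rpow_of_exponent_le h hp1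
    linarith

lemma integrable_rpow_of_lintegral_min_lt_top {d : ℕ}
    {π : Measure (EuclideanSpace ℝ (Fin d))} {p q : ℝ} (hp : 0 < p) (hqp : q ≤ p)
    (hq : ∫⁻ x, ENNReal.ofReal (min 1 (‖x‖ ^ q)) ∂π < ∞) :
    Integrable (fun x => ‖x‖ ^ p) (π.restrict (Metric.closedBall 0 1)) := by
  refine ⟨(by fun_prop : Measurable _).aestronglyMeasurable, ?_⟩
  rw [hasFiniteIntegral_iff_ofReal (ae_of_all _ fun x => by positivity)]
  refine lt_of_le_of_lt ?_ hq
  refine (setLIntegral_mono (g := fun x => ENNReal.ofReal (min 1 (‖x‖ ^ q))) (by fun_prop)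
    fun x hx => ?_).trans (setLIntegral_le_lintegral _ _)
  refine ENNReal.ofReal_le_ofReal ?_
  have hx1 : ‖x‖ ≤ 1 := by simpa using hx
  refine le_min (Real.rpow_le_one (norm_nonneg x) hx1 hp.le) ?_
  rcases (norm_nonneg x).eq_or_lt with h | h
  · rw [← h, Real.zero_rpow hp.ne']; positivity
  · exact Real.rpow_le_rpow_of_exponent_ge h hx1 hqp

lemma exists_integrable_rpow_of_blumenthalGetoorIndex_lt {d : ℕ}
    {π : Measure (EuclideanSpace ℝ (Fin d))} (hπ : IsLevyMeasure π) {δ : ℝ}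
    (hδ : blumenthalGetoorIndex π < δ) :
    0 < δ ∧ Integrable (fun x => ‖x‖ ^ (min δ 2)) (π.restrict (Metric.closedBall 0 1)) := by
  have h2 : ∫⁻ x, ENNReal.ofReal (min 1 (‖x‖ ^ (2 : ℝ))) ∂π < ∞ := by
    simpa only [Real.rpow_two] using hπ.lintegral_lt_top
  obtain ⟨q, ⟨hq0, hq⟩, hqδ⟩ := exists_lt_of_csInf_lt (s := {δ : ℝ | 0 ≤ δ ∧
    ∫⁻ x, ENNReal.ofReal (min 1 (‖x‖ ^ δ)) ∂π < ∞}) ⟨2, zero_le_two, h2⟩ hδ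
  have hδ0 : 0 < δ := hq0.trans_lt hqδ
  refine ⟨hδ0, ?_⟩
  rcases le_total δ 2 with h | h
  · rw [min_eq_left h]; exact integrable_rpow_of_lintegral_min_lt_top hδ0 hqδ.le hq
  · rw [min_eq_right h]; exact integrable_rpow_of_lintegral_min_lt_top two_pos le_rfl h2

/-- After adding a suitable drift, which is needed only for `δ < 1`, the exponent of the
compensated small jumps grows at most like `‖u‖ ^ min δ 2`, for every `δ` above the
Blumenthal–Getoor index. -/
lemma exists_norm_levyExponent_add_drift_le {d : ℕ}
    {π : Measure (EuclideanSpace ℝ (Fin d))} (hπ : IsLevyMeasure π) {δ : ℝ}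
    (hδ : blumenthalGetoorIndex π < δ) :
    ∃ (b : EuclideanSpace ℝ (Fin d)) (C : ℝ), 0 ≤ C ∧ (1 ≤ δ → b = 0) ∧ ∀ u,
      ‖levyExponent 0 0 (π.restrict (Metric.closedBall 0 1)) u
        + Complex.I * ((inner ℝ u b : ℝ) : ℂ)‖ ≤ C * ‖u‖ ^ (min δ 2) := by
  obtain ⟨hδ0, hint⟩ := exists_integrable_rpow_of_blumenthalGetoorIndex_lt hπ hδ
  set p := min δ 2 with hp
  have hp0 : 0 < p := lt_min hδ0 two_pos
  set ν := π.restrict (Metric.closedBall (0 : EuclideanSpace ℝ (Fin d)) 1) with hν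
  have hball : ∀ᵐ x ∂ν, x ∈ Metric.closedBall (0 : EuclideanSpace ℝ (Fin d)) 1 :=
    ae_restrict_mem measurableSet_closedBall
  have hexp : ∀ u, levyExponent 0 0 ν u
      = ∫ x, (Complex.exp (Complex.I * ((inner ℝ u x : ℝ) : ℂ)) - 1
          - Complex.I * ((inner ℝ u x : ℝ) : ℂ)) ∂ν := by
    intro u
    simp only [levyExponent, inner_zero_left, Matrix.zero_mulVec, dotProduct_zero,
      Complex.ofReal_zero, mul_zero, sub_zero, zero_add]
    refine integral_congr_ae ?_
    filter_upwards [hball] with x hx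
    rw [Set.indicator_of_mem hx]
  have hCS : ∀ u x : EuclideanSpace ℝ (Fin d), |inner ℝ u x| ^ p ≤ ‖u‖ ^ p * ‖x‖ ^ p :=
    fun u x => by
      rw [← Real.mul_rpow (norm_nonneg _) (norm_nonneg _)]
      exact Real.rpow_le_rpow (abs_nonneg _) (abs_real_inner_le_norm u x) hp0.le
  have hI : 0 ≤ ∫ x, ‖x‖ ^ p ∂ν := integral_nonneg fun x => by positivity
  rcases le_or_gt 1 δ with h1 | h1
  · refine ⟨0, 3 * ∫ x, ‖x‖ ^ p ∂ν, by positivity, fun _ => rfl, fun u => ?_⟩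
    rw [inner_zero_right, Complex.ofReal_zero, mul_zero, add_zero, hexp]
    calc _ ≤ ∫ x, 3 * ‖u‖ ^ p * ‖x‖ ^ p ∂ν := by
          refine norm_integral_le_of_norm_le (hint.const_mul _) (ae_of_all _ fun x => ?_)
          refine (norm_exp_I_mul_sub_one_sub_le_rpow (le_min h1 one_le_two)
            (min_le_right _ _) _).trans ?_
          rw [mul_assoc]
          gcongr
          exact hCS u x
      _ = _ := by rw [integral_const_mul]; ring
  · have hp1 : p ≤ 1 := (min_le_left _ _).trans h1.le
    have hid : Integrable (fun x => x) ν := by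
      refine hint.mono' measurable_id.aestronglyMeasurable ?_
      filter_upwards [hball] with x hx
      have hx1 : ‖x‖ ≤ 1 := by simpa using hx
      simpa using Real.rpow_le_rpow_of_exponent_ge' (norm_nonneg x) hx1 hp0.le hp1
    refine ⟨∫ x, x ∂ν, 2 * ∫ x, ‖x‖ ^ p ∂ν, by positivity,
      fun h => absurd h (not_le.2 h1), fun u => ?_⟩
    have hinner : Integrable (fun x => Complex.I * ((inner ℝ u x : ℝ) : ℂ)) ν :=
      ((hid.const_inner u).ofReal).const_mul _
    have hexpint : Integrable
        (fun x => Complex.exp (Complex.I * ((inner ℝ u x : ℝ) : ℂ)) - 1) ν := by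
      refine (hint.const_mul (2 * ‖u‖ ^ p)).mono'
        (by fun_prop : Measurable _).aestronglyMeasurable (ae_of_all _ fun x => ?_)
      refine (norm_exp_I_mul_sub_one_le_rpow hp0.le hp1 _).trans ?_
      rw [mul_assoc]
      gcongr
      exact hCS u x
    have hdrift : ∫ x, Complex.I * ((inner ℝ u x : ℝ) : ℂ) ∂ν
        = Complex.I * ((inner ℝ u (∫ x, x ∂ν) : ℝ) : ℂ) := by
      rw [integral_const_mul, ← integral_inner hid u]
      congr 1
      exact integral_ofReal
    rw [hexp, integral_sub hexpint hinner, hdrift, sub_add_cancel]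
    calc _ ≤ ∫ x, 2 * ‖u‖ ^ p * ‖x‖ ^ p ∂ν := by
          refine norm_integral_le_of_norm_le (hint.const_mul _) (ae_of_all _ fun x => ?_)
          refine (norm_exp_I_mul_sub_one_le_rpow hp0.le hp1 _).trans ?_
          rw [mul_assoc]
          gcongr
          exact hCS u x
      _ = _ := by rw [integral_const_mul]; ring

lemma norm_exp_sub_one_le_two_mul {z : ℂ} (hz : ‖Complex.exp z‖ ≤ 1) :
    ‖Complex.exp z - 1‖ ≤ 2 * ‖z‖ := by
  rcases le_total ‖z‖ 1 with h | h
  · exact Complex.norm_exp_sub_one_le h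
  · calc ‖Complex.exp z - 1‖ ≤ ‖Complex.exp z‖ + ‖(1 : ℂ)‖ := norm_sub_le _ _
      _ ≤ 1 + 1 := by gcongr; simp
      _ ≤ 2 * ‖z‖ := by linarith

/-- The characteristic function of an increment of length `h` of the process with drift `b` differs
from one by at most a multiple of `h`, with no restriction on `h`. -/
lemma norm_integral_exp_increment_sub_one_le {Ω : Type*} [MeasurableSpace Ω] {P : Measure Ω}
    [IsProbabilityMeasure P] {d : ℕ} {ν : Measure (EuclideanSpace ℝ (Fin d))}
    {Y : ℝ≥0 → Ω → EuclideanSpace ℝ (Fin d)} (hY : IsLevyProcess Y P 0 0 ν)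
    (b v : EuclideanSpace ℝ (Fin d)) (s h : ℝ≥0) :
    ‖(∫ ω, Complex.exp (Complex.I * ((inner ℝ v (Y (s + h) ω + ((s + h : ℝ≥0) : ℝ) • b)
        - inner ℝ v (Y s ω + (s : ℝ) • b) : ℝ) : ℂ)) ∂P) - 1‖
      ≤ 2 * ‖levyExponent 0 0 ν v + Complex.I * ((inner ℝ v b : ℝ) : ℂ)‖ * h := by
  set E := ∫ ω, Complex.exp (Complex.I * ((inner ℝ v (Y (s + h) ω + ((s + h : ℝ≥0) : ℝ) • b)
        - inner ℝ v (Y s ω + (s : ℝ) • b) : ℝ) : ℂ)) ∂P with hE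
  have hEle : ‖E‖ ≤ 1 := by
    have := norm_integral_le_of_norm_le_const (μ := P) (C := 1)
      (f := fun ω => Complex.exp (Complex.I * ((inner ℝ v (Y (s + h) ω
        + ((s + h : ℝ≥0) : ℝ) • b) - inner ℝ v (Y s ω + (s : ℝ) • b) : ℝ) : ℂ)))
      (ae_of_all _ fun ω => by rw [mul_comm, Complex.norm_exp_ofReal_mul_I])
    rwa [probReal_univ, mul_one, ← hE] at this
  have hEeq : E = Complex.exp (((h : ℝ) : ℂ) * (levyExponent 0 0 ν v
      + Complex.I * ((inner ℝ v b : ℝ) : ℂ))) := by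
    have h1 : ∀ ω, Complex.exp (Complex.I * ((inner ℝ v (Y (s + h) ω
          + ((s + h : ℝ≥0) : ℝ) • b) - inner ℝ v (Y s ω + (s : ℝ) • b) : ℝ) : ℂ))
        = Complex.exp (((inner ℝ (Y (s + h) ω - Y s ω) v : ℝ) : ℂ) * Complex.I)
          * Complex.exp (((h : ℝ) : ℂ) * (Complex.I * ((inner ℝ v b : ℝ) : ℂ))) := by
      intro ω
      rw [← Complex.exp_add, real_inner_comm v (Y (s + h) ω - Y s ω)]
      congr 1
      simp only [inner_add_right, inner_sub_right, real_inner_smul_right]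
      push_cast
      ring
    rw [hE]
    simp_rw [h1]
    rw [integral_mul_const]
    have hm : Measurable fun ω => Y (s + h) ω - Y s ω := (hY.measurable _).sub (hY.measurable _)
    have h2 : ∫ ω, Complex.exp (((inner ℝ (Y (s + h) ω - Y s ω) v : ℝ) : ℂ) * Complex.I) ∂P
        = charFun (P.map (fun ω => Y (s + h) ω - Y s ω)) v := by
      rw [charFun_apply, integral_map hm.aemeasurable]
      exact (by fun_prop : Measurable _).aestronglyMeasurable
    rw [h2, (hY.stationary_increments s h).map_eq, hY.charFun_eq, ← Complex.exp_add]
    congr 1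
    ring
  rw [hEeq] at hEle ⊢
  refine (norm_exp_sub_one_le_two_mul hEle).trans (le_of_eq ?_)
  rw [norm_mul, Complex.norm_real, Real.norm_of_nonneg h.coe_nonneg]
  ring

/-! ### Control of dyadic windows -/

/-- The path `f` with drift `b` is controlled at scale `2⁻ⁿ`. Let `ε = 2 · 2 ^ (-n / δ)` and
consider the windows of length `2⁻ⁿ` starting at multiples of `2⁻ⁿ / 2` in `[0, 1]`; whenever the
increments of a coordinate of `f + b t` over all sufficiently short parts of a window are at
most `ε` (so the window contains no large jump), that coordinate moves by at most `4 n ε` in the window. -/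
def HasWindowControl {d : ℕ} (f : ℝ≥0 → EuclideanSpace ℝ (Fin d)) (b : EuclideanSpace ℝ (Fin d))
    (δ : ℝ) (n : ℕ) : Prop :=
  ∀ k : ℕ, k ≤ 2 ^ (n + 1) → ∀ i : Fin d, ∀ a L : ℝ≥0, ∀ ε : ℝ,
    L = (1 / 2) ^ n → a = k * (L / 2) → ε = 2 * (L : ℝ) ^ (1 / δ) →
    (∃ θ > 0, ∀ s ∈ Set.Icc a (a + L), ∀ t ∈ Set.Icc a (a + L), dist s t < θ →
      |(f s + (s : ℝ) • b) i - (f t + (t : ℝ) • b) i| ≤ ε) →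
    ∀ t ∈ Set.Icc a (a + L), |(f t + (t : ℝ) • b) i - (f a + (a : ℝ) • b) i| ≤ 4 * n * ε

section Probability

variable {Ω : Type*} [MeasurableSpace Ω] {P : Measure Ω} [IsProbabilityMeasure P] {d : ℕ}
  {ν : Measure (EuclideanSpace ℝ (Fin d))} {Y : ℝ≥0 → Ω → EuclideanSpace ℝ (Fin d)}

/-- The two-sided window estimate for a coordinate of the process with drift `b`, in the scale `ε`
of the allowed steps. The exponent bound at `u` of norm `1 / ε` makes the estimate useful for
windows of length `L` up to about `ε ^ p`. -/
lemma measure_exists_lt_abs_sub_le (hY : IsLevyProcess Y P 0 0 ν)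
    {b : EuclideanSpace ℝ (Fin d)} {C p : ℝ} (hC : 0 ≤ C)
    (hψ : ∀ u, ‖levyExponent 0 0 ν u + Complex.I * ((inner ℝ u b : ℝ) : ℂ)‖ ≤ C * ‖u‖ ^ p)
    (i : Fin d) {ε : ℝ} (hε : 0 < ε) (a : ℝ≥0) {L : ℝ≥0} (hL : 0 < L) (M : ℝ) :
    P {ω | IsCadlag (fun t => Y t ω) ∧
        (∃ θ > 0, ∀ s ∈ Set.Icc a (a + L), ∀ t ∈ Set.Icc a (a + L), dist s t < θ →
          |(Y s ω + (s : ℝ) • b) i - (Y t ω + (t : ℝ) • b) i| ≤ ε) ∧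
        ∃ t ∈ Set.Icc a (a + L), M * ε < |(Y t ω + (t : ℝ) • b) i - (Y a ω + (a : ℝ) • b) i|}
      ≤ 2 * ENNReal.ofReal (Real.exp (3 * C * (ε ^ (-p) * L) - M / 2)) := by
  -- the process rescaled so that the allowed steps have size one
  let v : ℝ → EuclideanSpace ℝ (Fin d) := fun σ => (σ * ε⁻¹) • EuclideanSpace.single i 1
  let W : ℝ → ℝ≥0 → Ω → ℝ := fun σ t ω => inner ℝ (v σ) (Y t ω + (t : ℝ) • b)
  have hWeq : ∀ σ t ω, W σ t ω = σ * ε⁻¹ * (Y t ω + (t : ℝ) • b) i := fun σ t ω => by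
    simp only [W, v, real_inner_smul_left, EuclideanSpace.inner_single_left, map_one, one_mul]
  have hvn : ∀ σ : ℝ, |σ| = 1 → ‖v σ‖ = ε⁻¹ := fun σ hσ => by
    simp [v, norm_smul, hσ, abs_of_pos hε]
  have hmain : ∀ σ : ℝ, |σ| = 1 →
      P {ω | (∀ t, ContinuousWithinAt (fun s => W σ s ω) (Set.Ici t) t) ∧
        (∃ θ > 0, ∀ s ∈ Set.Icc a (a + L), ∀ t ∈ Set.Icc a (a + L), dist s t < θ →
          |W σ s ω - W σ t ω| ≤ 1) ∧
        ∃ t ∈ Set.Icc a (a + L), M < W σ t ω - W σ a ω}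
      ≤ ENNReal.ofReal (Real.exp (3 * C * (ε ^ (-p) * L) - M / 2)) := by
    intro σ hσ
    have hWm : ∀ t, Measurable (W σ t) := fun t => by
      have := hY.measurable t
      fun_prop
    have hWind : HasIndepIncrements (W σ) P := by
      refine .of_nat fun τ hτ _ => ?_
      have h := (hY.indep_increments.nat hτ).comp
        (fun j x => inner ℝ (v σ) (x + ((τ (j + 1) : ℝ) - τ j) • b)) (fun j => by fun_prop)
      convert h using 2 with j
      funext ω
      simp only [W, Function.comp_apply, inner_add_right, inner_sub_right,
        real_inner_smul_right]
      ring
    have h := measure_exists_lt_sub_le hWm hWind (c := 2 * (C * (ε⁻¹) ^ p)) (by positivity)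
      (fun s h => (norm_integral_exp_increment_sub_one_le hY b (v σ) s h).trans (by
        gcongr
        have := hψ (v σ)
        rwa [hvn σ hσ] at this)) a hL M
    refine h.trans (le_of_eq ?_)
    congr 3
    rw [Real.rpow_neg hε.le, Real.inv_rpow hε.le]
    ring
  rw [two_mul]
  refine (measure_mono ?_).trans ((measure_union_le _ _).trans
    (add_le_add (hmain 1 (by simp)) (hmain (-1) (by simp))))
  rintro ω ⟨hcad, ⟨θ, hθ, hosc⟩, t, ht, hM⟩
  have hrc : ∀ σ t, ContinuousWithinAt (fun s => W σ s ω) (Set.Ici t) t := fun σ t => by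
    have h1 := (hcad t).1
    have h2 : ContinuousWithinAt (fun s : ℝ≥0 => (s : ℝ) • b) (Set.Ici t) t :=
      (by fun_prop : Continuous fun s : ℝ≥0 => (s : ℝ) • b).continuousWithinAt
    exact (innerSL ℝ (v σ)).continuous.continuousAt.comp_continuousWithinAt (h1.add h2)
  have hosc' : ∀ σ : ℝ, |σ| = 1 → ∀ s ∈ Set.Icc a (a + L), ∀ t ∈ Set.Icc a (a + L),
      dist s t < θ → |W σ s ω - W σ t ω| ≤ 1 := fun σ hσ s hs t ht hst => by
    rw [hWeq, hWeq, ← mul_sub, abs_mul, abs_mul, hσ, one_mul, abs_of_pos (inv_pos.2 hε),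
      inv_mul_le_iff₀ hε, mul_one]
    exact hosc s hs t ht hst
  rcases lt_abs.1 hM with h | h
  · refine Or.inl ⟨hrc 1, ⟨θ, hθ, hosc' 1 (by simp)⟩, t, ht, ?_⟩
    rw [hWeq, hWeq, ← mul_sub, one_mul, ← div_eq_inv_mul, lt_div_iff₀ hε]
    exact h
  · refine Or.inr ⟨hrc (-1), ⟨θ, hθ, hosc' (-1) (by simp)⟩, t, ht, ?_⟩
    rw [hWeq, hWeq, ← mul_sub, mul_assoc, mul_left_comm, ← div_eq_inv_mul, lt_div_iff₀ hε]
    linarith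

/-- At level `n` there are of order `2ⁿ` windows, and each coordinate is out of control in a given
window with probability at most `2 exp (3 C - 2 n)`; so Borel–Cantelli applies. -/
lemma ae_eventually_hasWindowControl (hY : IsLevyProcess Y P 0 0 ν)
    {b : EuclideanSpace ℝ (Fin d)} {C p δ : ℝ} (hC : 0 ≤ C) (hδ : 0 < δ) (hp : 0 ≤ p)
    (hpδ : p ≤ δ)
    (hψ : ∀ u, ‖levyExponent 0 0 ν u + Complex.I * ((inner ℝ u b : ℝ) : ℂ)‖ ≤ C * ‖u‖ ^ p) :
    ∀ᵐ ω ∂P, ∀ᶠ n : ℕ in atTop, HasWindowControl (fun t => Y t ω) b δ n := by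
  let L : ℕ → ℝ≥0 := fun n => (1 / 2) ^ n
  let ε : ℕ → ℝ := fun n => 2 * (L n : ℝ) ^ (1 / δ)
  let a : ℕ → ℕ → ℝ≥0 := fun n k => k * (L n / 2)
  let B : ℕ → ℕ → Fin d → Set Ω := fun n k i => {ω | IsCadlag (fun t => Y t ω) ∧
        (∃ θ > 0, ∀ s ∈ Set.Icc (a n k) (a n k + L n), ∀ t ∈ Set.Icc (a n k) (a n k + L n),
          dist s t < θ → |(Y s ω + (s : ℝ) • b) i - (Y t ω + (t : ℝ) • b) i| ≤ ε n) ∧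
        ∃ t ∈ Set.Icc (a n k) (a n k + L n), 4 * n * ε n <
          |(Y t ω + (t : ℝ) • b) i - (Y (a n k) ω + (a n k : ℝ) • b) i|}
  have hL : ∀ n, 0 < L n := fun n => by positivity
  have hLr : ∀ n, (0 : ℝ) < L n := fun n => hL n
  have hL1 : ∀ n, (L n : ℝ) ≤ 1 := fun n => by
    have : L n ≤ 1 := pow_le_one₀ zero_le (by norm_num)
    exact_mod_cast this
  have hε : ∀ n, 0 < ε n := fun n => mul_pos two_pos (Real.rpow_pos_of_pos (hLr n) _)
  have hεL : ∀ n, ε n ^ (-p) * L n ≤ 1 := by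
    intro n
    have h1 : (L n : ℝ) ^ (p / δ) ≤ ε n ^ p := by
      have e : (L n : ℝ) ^ (p / δ) = ((L n : ℝ) ^ (1 / δ)) ^ p := by
        rw [← Real.rpow_mul (hLr n).le]; congr 1; ring
      rw [e]
      refine Real.rpow_le_rpow (by positivity) ?_ hp
      have : (0 : ℝ) ≤ (L n : ℝ) ^ (1 / δ) := by positivity
      simp only [ε]; linarith
    have h2 : (L n : ℝ) ≤ (L n : ℝ) ^ (p / δ) := by
      have := Real.rpow_le_rpow_of_exponent_ge (hLr n) (hL1 n) ((div_le_one hδ).2 hpδ)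
      rwa [Real.rpow_one] at this
    have hpos := Real.rpow_pos_of_pos (hε n) p
    rw [Real.rpow_neg (hε n).le, inv_mul_le_iff₀ hpos, mul_one]
    exact h2.trans h1
  have hB : ∀ n k i, P (B n k i) ≤ 2 * ENNReal.ofReal (Real.exp (3 * C - 2 * n)) := by
    intro n k i
    refine (measure_exists_lt_abs_sub_le hY hC hψ i (hε n) (a n k) (hL n) (4 * n)).trans ?_
    gcongr 2 * ENNReal.ofReal (Real.exp ?_)
    have := mul_le_mul_of_nonneg_left (hεL n) (by positivity : 0 ≤ 3 * C)
    linarith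
  let A : ℕ → Set Ω := fun n => ⋃ k ∈ Finset.range (2 ^ (n + 1) + 1), ⋃ i ∈ Finset.univ, B n k i
  have hA : ∀ n, P (A n) ≤ ENNReal.ofReal (6 * d * Real.exp (3 * C) * Real.exp (-1) ^ n) := by
    intro n
    calc P (A n) ≤ ∑ k ∈ Finset.range (2 ^ (n + 1) + 1), ∑ i : Fin d, P (B n k i) :=
          (measure_biUnion_finset_le _ _).trans
            (Finset.sum_le_sum fun k _ => measure_biUnion_finset_le _ _)
      _ ≤ ∑ k ∈ Finset.range (2 ^ (n + 1) + 1), ∑ i : Fin d,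
            2 * ENNReal.ofReal (Real.exp (3 * C - 2 * n)) :=
          Finset.sum_le_sum fun k _ => Finset.sum_le_sum fun i _ => hB n k i
      _ = ENNReal.ofReal (((2 ^ (n + 1) + 1 : ℕ) : ℝ) * (d * (2 * Real.exp (3 * C - 2 * n)))) := by
          simp only [Finset.sum_const, Finset.card_range, Finset.card_univ, Fintype.card_fin,
            nsmul_eq_mul]
          rw [ENNReal.ofReal_mul (by positivity), ENNReal.ofReal_mul (by positivity),
            ENNReal.ofReal_mul (by positivity), ENNReal.ofReal_natCast, ENNReal.ofReal_natCast,
            ENNReal.ofReal_ofNat]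
      _ ≤ _ := by
          refine ENNReal.ofReal_le_ofReal ?_
          have h1 : ((2 ^ (n + 1) + 1 : ℕ) : ℝ) ≤ 3 * Real.exp n := by
            have h2 : (2 : ℝ) ^ n ≤ Real.exp n := by
              rw [← Real.exp_one_pow]
              gcongr
              linarith [Real.exp_one_gt_d9]
            have h3 : (1 : ℝ) ≤ 2 ^ n := one_le_pow₀ one_le_two
            push_cast
            rw [pow_succ]
            linarith
          have h4 : Real.exp (3 * C - 2 * n)
              = Real.exp (3 * C) * (Real.exp (-1) ^ n * Real.exp (-n)) := by
            rw [← Real.exp_nat_mul, ← Real.exp_add, ← Real.exp_add]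
            congr 1; ring
          have h5 : Real.exp n * Real.exp (-n) = 1 := by rw [← Real.exp_add]; simp
          calc _ ≤ 3 * Real.exp n * (d * (2 * Real.exp (3 * C - 2 * n))) := by gcongr
            _ = 6 * d * Real.exp (3 * C) * Real.exp (-1) ^ n * (Real.exp n * Real.exp (-n)) := by
              rw [h4]; ring
            _ = _ := by rw [h5, mul_one]
  have hsum : ∑' n, P (A n) ≠ ∞ := by
    have hs : Summable fun n : ℕ => 6 * d * Real.exp (3 * C) * Real.exp (-1) ^ n :=
      (summable_geometric_of_lt_one (Real.exp_pos _).le (by simp)).mul_left _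
    exact ((ENNReal.tsum_le_tsum hA).trans_lt hs.tsum_ofReal_lt_top).ne
  filter_upwards [ae_eventually_notMem hsum, hY.cadlag] with ω hω hcad
  filter_upwards [hω] with n hn k hk i a' L' ε' hL' ha' hε' hosc t ht
  subst hL' ha' hε'
  by_contra! hlt
  have hmem : ω ∈ B n k i := ⟨hcad, hosc, t, ht, hlt⟩
  exact hn (Set.mem_iUnion₂.2 ⟨k, Finset.mem_range.2 (Nat.lt_succ_of_le hk),
    Set.mem_iUnion₂.2 ⟨i, Finset.mem_univ i, hmem⟩⟩)

end Probability

/-! ### Pointwise regularity of the path -/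

section Path

variable {d : ℕ} {f : ℝ≥0 → EuclideanSpace ℝ (Fin d)}

/-- Near a point outside the limsup set, where the path does not jump, the jumps are dominated by
the power `1 / δ` of their distance to the point. -/
lemma exists_forall_norm_pathJump_le_rpow (hf : IsCadlag f) {δ : ℝ} (hδ : 0 < δ) {t : ℝ≥0}
    (ht : t ∉ jumpTimes f) (htA : t ∉ jaffardSet f δ) :
    ∃ ρ > 0, ∀ s, dist s t < ρ → ‖pathJump f s‖ ≤ dist s t ^ (1 / δ) := by
  rw [jaffardSet, mem_limsup_iff_frequently_mem, not_frequently] at htA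
  obtain ⟨ε, hεA, hε⟩ := (htA.and self_mem_nhdsWithin).exists
  obtain ⟨ρ, hρ, h⟩ := exists_forall_norm_pathJump_le hf ht hε
  refine ⟨ρ, hρ, fun s hs => ?_⟩
  by_cases hsJ : s ∈ jumpTimes f
  · have hlt : ‖pathJump f s‖ ^ δ ≤ dist s t := by
      by_contra! hlt
      refine hεA (Set.mem_iUnion₂.2 ⟨s, ⟨hsJ, h s hs⟩, ?_⟩)
      rw [NNReal.dist_eq] at hlt
      have := abs_lt.1 hlt
      constructor <;> linarith
    calc ‖pathJump f s‖ = (‖pathJump f s‖ ^ δ) ^ (1 / δ) := by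
          rw [← Real.rpow_mul (norm_nonneg _), mul_one_div_cancel hδ.ne', Real.rpow_one]
      _ ≤ dist s t ^ (1 / δ) := by gcongr
  · have : pathJump f s = 0 := by simpa [jumpTimes] using hsJ
    rw [this, norm_zero]
    positivity

lemma norm_le_card_mul_of_forall_abs_le {x : EuclideanSpace ℝ (Fin d)} {c : ℝ}
    (h : ∀ i, |x i| ≤ c) : ‖x‖ ≤ d * c := by
  calc ‖x‖ = ‖∑ i, (EuclideanSpace.basisFun (Fin d) ℝ).repr x i •
          EuclideanSpace.basisFun (Fin d) ℝ i‖ := by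
        rw [OrthonormalBasis.sum_repr]
    _ ≤ ∑ i : Fin d, c := by
        refine (norm_sum_le _ _).trans (Finset.sum_le_sum fun i _ => ?_)
        simpa [norm_smul] using h i
    _ = d * c := by simp

/-- Window control at all fine scales bounds the increments, corrected by the drift `b`, by a
multiple of `n 2 ^ (-n / δ)` at scale `2⁻ⁿ` near every point at which jumps are dominated by the
power `1 / δ` of their distance: such jumps are too small to spoil the windows around the point. -/
lemma eventually_norm_sub_le_of_hasWindowControl {b : EuclideanSpace ℝ (Fin d)} (hf : IsCadlag f)
    {δ : ℝ} (hδ : 0 < δ)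
    (H : ∀ᶠ n : ℕ in atTop, HasWindowControl f b δ n)
    {t : ℝ≥0} (ht1 : t ≤ 1) {ρ : ℝ} (hρ : 0 < ρ)
    (hjump : ∀ s, dist s t < ρ → ‖pathJump f s‖ ≤ dist s t ^ (1 / δ)) :
    ∀ᶠ n : ℕ in atTop, ∀ u, dist u t ≤ (1 / 2) ^ (n + 1) →
      ‖(f u + (u : ℝ) • b) - (f t + (t : ℝ) • b)‖
        ≤ d * (16 * n * ((1 / 2 : ℝ) ^ n) ^ (1 / δ)) := by
  have hsmall : ∀ᶠ n : ℕ in atTop, (1 / 2 : ℝ) ^ n < ρ :=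
    (tendsto_pow_atTop_nhds_zero_of_lt_one (by norm_num) (by norm_num)).eventually
      (gt_mem_nhds hρ)
  filter_upwards [H, hsmall] with n hn hnρ u hu
  refine norm_le_card_mul_of_forall_abs_le fun i => ?_
  set L : ℝ≥0 := (1 / 2) ^ n with hL
  have hLr : (L : ℝ) = (1 / 2) ^ n := by rw [hL]; push_cast; rfl
  have hL0 : (0 : ℝ) < L := by rw [hLr]; positivity
  have hu' : |(u : ℝ) - t| ≤ L / 2 := by
    rw [NNReal.dist_eq, pow_succ] at hu
    rw [hLr]; linarith
  rw [abs_le] at hu'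
  set ε : ℝ := 2 * (L : ℝ) ^ (1 / δ) with hε
  have hLδ : 0 < (L : ℝ) ^ (1 / δ) := Real.rpow_pos_of_pos hL0 _
  -- the window starts at the last multiple of `L / 2` before both points
  set w : ℝ := min t u with hw
  have hw0 : 0 ≤ w := le_min t.2 u.2
  have hwt : w ≤ t := min_le_left _ _
  have hwu : w ≤ u := min_le_right _ _
  have htw : (t : ℝ) ≤ w + L / 2 := by
    rcases min_choice (t : ℝ) u with h | h <;> rw [hw, h] <;> linarith
  have huw : (u : ℝ) ≤ w + L / 2 := by
    rcases min_choice (t : ℝ) u with h | h <;> rw [hw, h] <;> linarith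
  have hL2 : (0 : ℝ) < L / 2 := by positivity
  set k := ⌊w / (L / 2)⌋₊ with hk
  have hk1 : k * ((L : ℝ) / 2) ≤ w :=
    (le_div_iff₀ hL2).1 (Nat.floor_le (by positivity))
  have hk2 : w < k * ((L : ℝ) / 2) + L / 2 := by
    have := (div_lt_iff₀ hL2).1 (Nat.lt_floor_add_one (w / ((L : ℝ) / 2)))
    rwa [← hk, add_mul, one_mul] at this
  have hkn : k ≤ 2 ^ (n + 1) := by
    have ht1' : (t : ℝ) ≤ 1 := by exact_mod_cast ht1
    have h1 : (k : ℝ) * (L / 2) ≤ 2 ^ (n + 1) * (L / 2) := by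
      have : (2 : ℝ) ^ (n + 1) * (L / 2) = 1 := by
        rw [hLr, one_div, inv_pow, pow_succ]; field_simp
      linarith
    exact_mod_cast le_of_mul_le_mul_right h1 hL2
  set a : ℝ≥0 := k * (L / 2) with ha
  have har : (a : ℝ) = k * (L / 2) := by rw [ha]; push_cast; rfl
  have hmem : ∀ s : ℝ≥0, s ∈ Set.Icc a (a + L) ↔ (a : ℝ) ≤ s ∧ (s : ℝ) ≤ a + L := fun s => by
    rw [Set.mem_Icc, ← NNReal.coe_le_coe, ← NNReal.coe_le_coe, NNReal.coe_add]
  have htm : t ∈ Set.Icc a (a + L) := (hmem t).2 ⟨by linarith, by linarith⟩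
  have hum : u ∈ Set.Icc a (a + L) := (hmem u).2 ⟨by linarith, by linarith⟩
  have hosc := exists_forall_dist_lt_of_jump_le (f := fun s => (f s + (s : ℝ) • b) i)
    (a := a) (b := a + L) (η := (L : ℝ) ^ (1 / δ)) (ε := ε) (by linarith)
    (fun s _ => by
      have h1 : ContinuousWithinAt (fun s : ℝ≥0 => f s + (s : ℝ) • b) (Set.Ici s) s :=
        (hf s).1.add (by fun_prop : Continuous fun s : ℝ≥0 => (s : ℝ) • b).continuousWithinAt
      exact (EuclideanSpace.proj i : EuclideanSpace ℝ (Fin d) →L[ℝ] ℝ).continuous.continuousAt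
        |>.comp_continuousWithinAt h1)
    (fun s hs => by
      refine ⟨(Function.leftLim f s + (s : ℝ) • b) i, ?_, ?_⟩
      · have h1 : Tendsto (fun s : ℝ≥0 => f s + (s : ℝ) • b) (𝓝[<] s)
            (𝓝 (Function.leftLim f s + (s : ℝ) • b)) :=
          (tendsto_leftLim_of_tendsto (hf s).2).add
            ((by fun_prop : Continuous fun s : ℝ≥0 => (s : ℝ) • b).tendsto s |>.mono_left
              nhdsWithin_le_nhds)
        exact ((EuclideanSpace.proj i : EuclideanSpace ℝ (Fin d) →L[ℝ] ℝ).continuous.tendsto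
          _).comp h1
      · have hst : dist s t ≤ L := by
          rw [NNReal.dist_eq, abs_le]
          have h1 := (hmem s).1 hs
          have h2 := (hmem t).1 htm
          constructor <;> linarith
        have e : (f s + (s : ℝ) • b) i - (Function.leftLim f s + (s : ℝ) • b) i
            = pathJump f s i := by simp [pathJump]
        rw [e]
        refine (PiLp.norm_apply_le (pathJump f s) i).trans ?_
        refine (hjump s (hst.trans_lt (hLr ▸ hnρ))).trans ?_
        gcongr)
  have h := hn k hkn i a L ε rfl rfl rfl hosc
  have h1 := abs_le.1 (h t htm)
  have h2 := abs_le.1 (h u hum)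
  have h3 : 4 * n * ε + 4 * n * ε = 16 * n * ((1 / 2 : ℝ) ^ n) ^ (1 / δ) := by
    rw [hε, hLr]; ring
  rw [← h3, PiLp.sub_apply, abs_le]
  constructor <;> linarith

lemma natCast_mul_rpow_le {η : ℝ} (hη : 0 < η) (n : ℕ) :
    n * ((1 / 2 : ℝ) ^ n) ^ η ≤ 1 / (η * Real.log 2) := by
  have hlog : 0 < Real.log 2 := Real.log_pos one_lt_two
  have e : ((1 / 2 : ℝ) ^ n) ^ η = (Real.exp (n * (η * Real.log 2)))⁻¹ := by
    rw [Real.rpow_def_of_pos (by positivity), ← Real.exp_neg, Real.log_pow, one_div, Real.log_inv]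
    congr 1; ring
  rw [e, ← div_eq_mul_inv, div_le_div_iff₀ (Real.exp_pos _) (by positivity), one_mul]
  linarith [Real.add_one_le_exp (n * (η * Real.log 2))]

lemma memPointwiseHolder_of_forall_dyadic {b : EuclideanSpace ℝ (Fin d)} {δ : ℝ}
    {t : ℝ≥0} {K : ℝ} (hK : 0 ≤ K)
    (H : ∀ᶠ n : ℕ in atTop, ∀ u, dist u t ≤ (1 / 2) ^ (n + 1) →
      ‖(f u + (u : ℝ) • b) - (f t + (t : ℝ) • b)‖ ≤ K * (n * ((1 / 2 : ℝ) ^ n) ^ (1 / δ)))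
    {α : ℝ} (hα0 : 0 < α) (hα1 : b = 0 ∨ 1 < α) (hαδ : α < 1 / δ) :
    MemPointwiseHolder f t α := by
  obtain ⟨n₀, hn₀⟩ := eventually_atTop.1 H
  set η := 1 / δ - α with hη
  have hη0 : 0 < η := sub_pos.2 hαδ
  have hlog : 0 < Real.log 2 := Real.log_pos one_lt_two
  refine ⟨K * ((1 / (η * Real.log 2)) * 4 ^ α) + 1, by positivity, (1 / 2) ^ (n₀ + 1),
    by positivity,
    fun i => Polynomial.C ((f t + (t : ℝ) • b) i) - Polynomial.C (b i) * Polynomial.X, ?_, ?_⟩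
  · intro i
    rcases hα1 with hb | hα1
    · simpa [hb] using hα0
    · refine lt_of_le_of_lt ?_ hα1
      have : (Polynomial.C ((f t + (t : ℝ) • b) i)
          - Polynomial.C (b i) * Polynomial.X).natDegree ≤ 1 := by compute_degree
      exact_mod_cast this
  · intro u hu
    have hval : f u - WithLp.toLp 2 (fun i => Polynomial.eval (u : ℝ)
        (Polynomial.C ((f t + (t : ℝ) • b) i) - Polynomial.C (b i) * Polynomial.X))
        = (f u + (u : ℝ) • b) - (f t + (t : ℝ) • b) := by
      ext i
      simp
      ring
    rw [hval]
    rcases eq_or_ne u t with rfl | hut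
    · simp [Real.zero_rpow hα0.ne']
    set r := |(t : ℝ) - u| with hr
    have hr0 : 0 < r := abs_pos.2 (sub_ne_zero.2 fun h => hut (NNReal.coe_injective h).symm)
    have hur : dist u t = r := by rw [NNReal.dist_eq, hr, abs_sub_comm]
    have hr1 : r < (1 / 2) ^ (n₀ + 1) := by rwa [abs_sub_comm] at hu
    -- the dyadic scale `n` with `2⁻ⁿ / 4 < r ≤ 2⁻ⁿ / 2`
    have hr2 : 2 * r < (1 / 2) ^ n₀ := by rw [pow_succ] at hr1; linarith
    obtain ⟨n, hn1, hn2⟩ := exists_nat_pow_near_of_lt_one (x := 2 * r) (y := (1 / 2 : ℝ))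
      (by positivity) (hr2.le.trans (pow_le_one₀ (by norm_num) (by norm_num)))
      (by norm_num) (by norm_num)
    have hnn : n₀ ≤ n := by
      have := (pow_lt_pow_iff_right_of_lt_one₀ (by norm_num : (0 : ℝ) < 1 / 2)
        (by norm_num)).1 (hn1.trans hr2)
      omega
    have hfin := hn₀ n hnn u (by rw [hur, pow_succ]; linarith)
    refine hfin.trans ?_
    have h4 : (1 / 2 : ℝ) ^ n ≤ 4 * r := by rw [pow_succ] at hn1; linarith
    have hsplit : ((1 / 2 : ℝ) ^ n) ^ (1 / δ)
        = ((1 / 2 : ℝ) ^ n) ^ η * ((1 / 2 : ℝ) ^ n) ^ α := by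
      rw [← Real.rpow_add (by positivity)]; congr 1; rw [hη]; ring
    calc K * (n * ((1 / 2 : ℝ) ^ n) ^ (1 / δ))
        = K * ((n * ((1 / 2 : ℝ) ^ n) ^ η) * ((1 / 2 : ℝ) ^ n) ^ α) := by rw [hsplit]; ring
      _ ≤ K * ((1 / (η * Real.log 2)) * (4 * r) ^ α) := by
          gcongr
          exact natCast_mul_rpow_le hη0 n
      _ = K * ((1 / (η * Real.log 2)) * 4 ^ α) * r ^ α := by
          rw [Real.mul_rpow (by norm_num) hr0.le]; ring
      _ ≤ (K * ((1 / (η * Real.log 2)) * 4 ^ α) + 1) * r ^ α := by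
          gcongr; linarith

lemma ofReal_le_pointwiseHolderExponent {t : ℝ≥0} {A c : ℝ} (hcA : c < A)
    (h : ∀ α, 0 < α → c < α → α < A → MemPointwiseHolder f t α) :
    ENNReal.ofReal A ≤ pointwiseHolderExponent f t := by
  refine le_of_forall_lt fun x hx => ?_
  have hxt : x ≠ ∞ := hx.ne_top
  have hxA : x.toReal < A := ENNReal.lt_ofReal_iff_toReal_lt hxt |>.1 hx
  obtain ⟨α, hα1, hα2⟩ := exists_between (max_lt hxA hcA)
  obtain ⟨hxα, hcα⟩ := max_lt_iff.1 hα1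
  have hα0 : 0 < α := ENNReal.toReal_nonneg.trans_lt hxα
  have hx2 : x < ENNReal.ofReal α := (ENNReal.lt_ofReal_iff_toReal_lt hxt).2 hxα
  exact hx2.trans_le (le_sSup ⟨α, hα0, h α hα0 hcα hα2, rfl⟩)

end Path

theorem mainTheorem5 {Ω : Type*} [MeasurableSpace Ω] (P : Measure Ω) [IsProbabilityMeasure P]
    (d : ℕ) (π : Measure (EuclideanSpace ℝ (Fin d))) (hπ : IsLevyMeasure π)
    (Y : ℝ≥0 → Ω → EuclideanSpace ℝ (Fin d))
    (hY : IsLevyProcess Y P 0 0 (π.restrict (Metric.closedBall 0 1)))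
    (δ : ℝ) (hδ : blumenthalGetoorIndex π < δ) :
    ∀ᵐ ω ∂P, ∀ t : ℝ≥0, t ≤ 1 → t ∉ jumpTimes (fun s => Y s ω) →
      t ∉ jaffardSet (fun s => Y s ω) δ →
        ENNReal.ofReal (1 / δ) ≤ pointwiseHolderExponent (fun s => Y s ω) t := by
  have hδ0 : 0 < δ := (exists_integrable_rpow_of_blumenthalGetoorIndex_lt hπ hδ).1
  obtain ⟨b, C, hC, hb, hψ⟩ := exists_norm_levyExponent_add_drift_le hπ hδ
  filter_upwards [hY.cadlag, ae_eventually_hasWindowControl hY hC hδ0 (le_min hδ0.le zero_le_two)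
    (min_le_left δ 2) hψ] with ω hcad hω t ht1 htJ htA
  obtain ⟨ρ, hρ, hjump⟩ := exists_forall_norm_pathJump_le_rpow hcad hδ0 htJ htA
  have hdy := eventually_norm_sub_le_of_hasWindowControl hcad hδ0 hω ht1 hρ hjump
  have hdy' : ∀ᶠ n : ℕ in atTop, ∀ u, dist u t ≤ (1 / 2) ^ (n + 1) →
      ‖(Y u ω + (u : ℝ) • b) - (Y t ω + (t : ℝ) • b)‖
        ≤ (d * 16 : ℝ) * (n * ((1 / 2 : ℝ) ^ n) ^ (1 / δ)) := by
    filter_upwards [hdy] with n hn u hu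
    exact (hn u hu).trans (le_of_eq (by ring))
  -- for `δ < 1` the drift is a polynomial of degree one, so only exponents above one are used
  rcases le_or_gt 1 δ with h1 | h1
  · exact ofReal_le_pointwiseHolderExponent (c := 0) (by positivity) fun α hα0 _ hα =>
      memPointwiseHolder_of_forall_dyadic (by positivity) hdy' hα0 (Or.inl (hb h1)) hα
  · exact ofReal_le_pointwiseHolderExponent (c := 1) ((one_lt_div hδ0).2 h1) fun α hα0 hα1 hα =>
      memPointwiseHolder_of_forall_dyadic (by positivity) hdy' hα0 (Or.inr hα1) hα
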